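/- Let $k$ be a field. A GDN-Poisson algebra over $k$ (with unit) is a $k$-vector space with two bilinear products $\cdot$ and $\circ$ such that $\cdot$ is commutative and associative with a unit $e$, and for all $x,y,z$ $$x\circ(y\circ z)-(x\circ y)\circ z=y\circ(x\circ z)-(y\circ x)\circ z,\qquad (x\circ y)\circ z=(x\circ z)\circ y,$$ $$(x\cdot y)\circ z=x\cdot(y\circ z),\qquad (x\circ y)\cdot z-x\circ(y\cdot z)=(y\circ x)\cdot z-y\circ(x\cdot z).$$ Let $X$ be a well-ordered set and let $GDNP(X)$ be the free GDN-Poisson algebra (with unit $e$) over $k$ generated by $X$. Order $X\cup\{e\}$ by extending the order of $X$ with $e<x$ for all $x\in X$. A GDN-Poisson tableau over $X$ is a word $$T=b_1\cdots b_m\cdot\bigl((\cdots((a_{1,r_1+1}\circ A_1)\circ A_2)\circ\cdots)\circ A_n\bigr),\qquad A_i=a_{i,r_i}\circ(\cdots\circ(a_{i,3}\circ(a_{i,2}\circ a_{i,1}))\cdots)\quad(1\le i\le n),$$ with $n,m\ge 0$, all $r_i\ge 1$, all $a_{i,j}\in X\cup\{e\}$ and all $b_i\in X$ (for $n=0$ the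 second factor is a single letter $a_{1,r_1+1}$; for $m=0$ the first factor is absent), such that (1) $r_1\ge r_2\ge\cdots\ge r_n$, and $a_{i,1}\ge a_{i+1,1}$ whenever $r_i=r_{i+1}$; (2) $a_{1,r_1+1}\ge a_{1,r_1}\ge\cdots\ge a_{1,2}\ge a_{2,r_2}\ge\cdots\ge a_{2,2}\ge\cdots\ge a_{n,r_n}\ge\cdots\ge a_{n,2}$ (a row $A_i$ with $r_i=1$ contributes no letter to this chain, and for $n=0$ the chain consists of $a_{1,r_1+1}$ only); (3) if $c$ denotes the last (smallest) letter of the chain in (2), then $c\ge b_1\ge\cdots\ge b_m$, and $m=0$ if $c=e$. Then the GDN-Poisson tableaux over $X$ form a linear basis of $GDNP(X)$: they represent pairwise distinct elements, are linearly independent over $k$, and span $GDNP(X)$. -/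

import Mathlib

/-- A Gelfand-Dorfman-Novikov-Poisson algebra over `k` (with unit for the product `·`): the
commutative associative unital algebra structure `·` is the `k`-algebra structure of `A`, and
`circ x y` is the second bilinear product `x ∘ y`. -/
class GDNPoissonAlgebra (k A : Type*) [Field k] [CommRing A] [Algebra k A] where
  circ : A →ₗ[k] A →ₗ[k] A
  left_symm : ∀ x y z : A,
    circ x (circ y z) - circ (circ x y) z = circ y (circ x z) - circ (circ y x) z
  right_comm : ∀ x y z : A, circ (circ x y) z = circ (circ x z) y
  mul_circ : ∀ x y z : A, circ (x * y) z = x * circ y z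
  circ_mul_sub : ∀ x y z : A,
    circ x y * z - circ x (y * z) = circ y x * z - circ y (x * z)

/-- The words in the letters `X ∪ {e}` and the two binary operation symbols `·`, `∘`. -/
inductive GDNPWord (X : Type*) where
  | e : GDNPWord X
  | of : X → GDNPWord X
  | dot : GDNPWord X → GDNPWord X → GDNPWord X
  | circ : GDNPWord X → GDNPWord X → GDNPWord X

namespace GDNPWord

variable (k : Type*) [Field k] {X : Type*}

/-- The bilinear extension of a binary operation on words to the vector space with basis the
words. -/
noncomputable def bilin (op : GDNPWord X → GDNPWord X → GDNPWord X) :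
    (GDNPWord X →₀ k) →ₗ[k] (GDNPWord X →₀ k) →ₗ[k] (GDNPWord X →₀ k) :=
  Finsupp.lift _ k _ fun u => Finsupp.lift _ k _ fun v => Finsupp.single (op u v) 1

theorem bilin_single (op : GDNPWord X → GDNPWord X → GDNPWord X) (u v : GDNPWord X) :
    bilin k op (Finsupp.single u 1) (Finsupp.single v 1) = Finsupp.single (op u v) 1 := by
  simp [bilin]

/-- The identities of GDN-Poisson algebras, evaluated at words (all identities are multilinear),
together with everything obtained from them by multiplying with words. -/
inductive Relator : (GDNPWord X →₀ k) → Prop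
  | dot_comm (u v : GDNPWord X) :
      Relator (.single (dot u v) 1 - .single (dot v u) 1)
  | dot_assoc (u v w : GDNPWord X) :
      Relator (.single (dot (dot u v) w) 1 - .single (dot u (dot v w)) 1)
  | e_dot (u : GDNPWord X) :
      Relator (.single (dot e u) 1 - .single u 1)
  | left_symm (u v w : GDNPWord X) :
      Relator ((.single (circ u (circ v w)) 1 - .single (circ (circ u v) w) 1) -
        (.single (circ v (circ u w)) 1 - .single (circ (circ v u) w) 1))
  | right_comm (u v w : GDNPWord X) :
      Relator (.single (circ (circ u v) w) 1 - .single (circ (circ u w) v) 1)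
  | dot_circ (u v w : GDNPWord X) :
      Relator (.single (circ (dot u v) w) 1 - .single (dot u (circ v w)) 1)
  | circ_dot_sub (u v w : GDNPWord X) :
      Relator ((.single (dot (circ u v) w) 1 - .single (circ u (dot v w)) 1) -
        (.single (dot (circ v u) w) 1 - .single (circ v (dot u w)) 1))
  | dot_left (u : GDNPWord X) (r : GDNPWord X →₀ k) :
      Relator r → Relator (bilin k dot (.single u 1) r)
  | dot_right (u : GDNPWord X) (r : GDNPWord X →₀ k) :
      Relator r → Relator (bilin k dot r (.single u 1))
  | circ_left (u : GDNPWord X) (r : GDNPWord X →₀ k) :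
      Relator r → Relator (bilin k circ (.single u 1) r)
  | circ_right (u : GDNPWord X) (r : GDNPWord X →₀ k) :
      Relator r → Relator (bilin k circ r (.single u 1))

variable (X) in
/-- The ideal of the free algebra (two bilinear products and a constant `e`) generated by the
identities of GDN-Poisson algebras. -/
noncomputable def relIdeal : Submodule k (GDNPWord X →₀ k) := Submodule.span k {r | Relator k r}

theorem bilin_mem {op : GDNPWord X → GDNPWord X → GDNPWord X}
    (hl : ∀ u r, Relator k r → Relator k (bilin k op (.single u 1) r))
    (a r : GDNPWord X →₀ k) (hr : r ∈ relIdeal k X) : bilin k op a r ∈ relIdeal k X := by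
  induction a using Finsupp.induction_linear with
  | zero => simp
  | add f g hf hg => rw [map_add, LinearMap.add_apply]; exact add_mem hf hg
  | single u c =>
    have h : Finsupp.single u c = c • Finsupp.single u (1 : k) := by simp
    rw [h, map_smul, LinearMap.smul_apply]
    refine Submodule.smul_mem _ _ ?_
    have hle : relIdeal k X ≤ (relIdeal k X).comap (bilin k op (.single u 1)) :=
      Submodule.span_le.2 fun r hr => Submodule.subset_span (hl u r hr)
    exact hle hr

theorem mem_bilin {op : GDNPWord X → GDNPWord X → GDNPWord X}
    (hl : ∀ u r, Relator k r → Relator k (bilin k op r (.single u 1)))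
    (a r : GDNPWord X →₀ k) (hr : r ∈ relIdeal k X) : bilin k op r a ∈ relIdeal k X := by
  induction a using Finsupp.induction_linear with
  | zero => simp
  | add f g hf hg => rw [map_add]; exact add_mem hf hg
  | single u c =>
    have h : Finsupp.single u c = c • Finsupp.single u (1 : k) := by simp
    rw [h, map_smul]
    refine Submodule.smul_mem _ _ ?_
    have hle : relIdeal k X ≤ (relIdeal k X).comap ((bilin k op).flip (.single u 1)) :=
      Submodule.span_le.2 fun r hr => Submodule.subset_span (hl u r hr)
    exact hle hr

/-- The product induced on the quotient by the ideal of relations. -/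
noncomputable def quotBilin (op : GDNPWord X → GDNPWord X → GDNPWord X)
    (hl : ∀ u r, Relator k r → Relator k (bilin k op (.single u 1) r))
    (hr : ∀ u r, Relator k r → Relator k (bilin k op r (.single u 1))) :
    ((GDNPWord X →₀ k) ⧸ relIdeal k X) →ₗ[k] ((GDNPWord X →₀ k) ⧸ relIdeal k X) →ₗ[k]
      ((GDNPWord X →₀ k) ⧸ relIdeal k X) :=
  (relIdeal k X).liftQ
    ((Submodule.mapQLinear (relIdeal k X) (relIdeal k X)).comp
      ((bilin k op).codRestrict _ fun a r h => bilin_mem k hl a r h))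
    (by
      intro r h
      rw [LinearMap.mem_ker]
      ext v
      change Submodule.Quotient.mk (bilin k op r (.single v 1)) = 0
      exact (Submodule.Quotient.mk_eq_zero _).2 (mem_bilin k hr _ r h))

end GDNPWord

/-- The free GDN-Poisson algebra (with unit `e`) over `k` generated by `X`. -/
def GDNP (k : Type*) [Field k] (X : Type*) : Type _ :=
  (GDNPWord X →₀ k) ⧸ GDNPWord.relIdeal k X

namespace GDNP

variable (k : Type*) [Field k] {X : Type*}

noncomputable instance : AddCommGroup (GDNP k X) :=
  inferInstanceAs (AddCommGroup ((GDNPWord X →₀ k) ⧸ GDNPWord.relIdeal k X))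

noncomputable instance : Module k (GDNP k X) :=
  inferInstanceAs (Module k ((GDNPWord X →₀ k) ⧸ GDNPWord.relIdeal k X))

/-- The canonical projection from the linear combinations of words. -/
noncomputable def mk : (GDNPWord X →₀ k) →ₗ[k] GDNP k X := (GDNPWord.relIdeal k X).mkQ

/-- The element of the free GDN-Poisson algebra represented by a word. -/
noncomputable def ofWord (w : GDNPWord X) : GDNP k X := mk k (Finsupp.single w 1)

/-- The product `·`. -/
noncomputable def dotMap : GDNP k X →ₗ[k] GDNP k X →ₗ[k] GDNP k X :=
  GDNPWord.quotBilin k GDNPWord.dot .dot_left .dot_right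

/-- The product `∘`. -/
noncomputable def circMap : GDNP k X →ₗ[k] GDNP k X →ₗ[k] GDNP k X :=
  GDNPWord.quotBilin k GDNPWord.circ .circ_left .circ_right

theorem dotMap_ofWord (u v : GDNPWord X) :
    dotMap k (ofWord k u) (ofWord k v) = ofWord k (u.dot v) :=
  congrArg (mk k) (GDNPWord.bilin_single k _ u v)

theorem circMap_ofWord (u v : GDNPWord X) :
    circMap k (ofWord k u) (ofWord k v) = ofWord k (u.circ v) :=
  congrArg (mk k) (GDNPWord.bilin_single k _ u v)

theorem mk_eq_zero {r : GDNPWord X →₀ k} (h : GDNPWord.Relator k r) : mk k r = 0 :=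
  (Submodule.Quotient.mk_eq_zero _).2 (Submodule.subset_span h)

theorem span_ofWord : Submodule.span k (Set.range (ofWord k (X := X))) = ⊤ := by
  rw [eq_top_iff]
  rintro a -
  obtain ⟨f, rfl⟩ := Submodule.mkQ_surjective _ a
  change mk k f ∈ _
  induction f using Finsupp.induction_linear with
  | zero => simp
  | add f g hf hg => rw [map_add]; exact add_mem hf hg
  | single u c =>
    have h : Finsupp.single u c = c • Finsupp.single u (1 : k) := by simp
    rw [h, map_smul]
    exact Submodule.smul_mem _ _ (Submodule.subset_span ⟨u, rfl⟩)

theorem induction {p : GDNP k X → Prop} (word : ∀ w, p (ofWord k w)) (zero : p 0)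
    (add : ∀ a b, p a → p b → p (a + b)) (smul : ∀ (c : k) a, p a → p (c • a))
    (a : GDNP k X) : p a := by
  have ha : a ∈ Submodule.span k (Set.range (ofWord k (X := X))) := by simp [span_ofWord]
  induction ha using Submodule.span_induction with
  | mem x h => obtain ⟨w, rfl⟩ := h; exact word w
  | zero => exact zero
  | add a b _ _ ha hb => exact add a b ha hb
  | smul c a _ ha => exact smul c a ha

theorem dotMap_comm (a b : GDNP k X) : dotMap k a b = dotMap k b a := by
  induction a using induction with
  | zero => simp
  | add a₁ a₂ h₁ h₂ => simp [h₁, h₂]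
  | smul c a h => simp [h]
  | word u =>
  induction b using induction with
  | zero => simp
  | add a₁ a₂ h₁ h₂ => simp [h₁, h₂]
  | smul c a h => simp [h]
  | word v =>
  simp only [dotMap_ofWord]
  exact sub_eq_zero.1 (mk_eq_zero k (.dot_comm u v))

theorem dotMap_assoc (a b c : GDNP k X) :
    dotMap k (dotMap k a b) c = dotMap k a (dotMap k b c) := by
  induction a using induction with
  | zero => simp
  | add a₁ a₂ h₁ h₂ => simp [h₁, h₂]
  | smul c a h => simp [h]
  | word u =>
  induction b using induction with
  | zero => simp
  | add a₁ a₂ h₁ h₂ => simp [h₁, h₂]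
  | smul c a h => simp [h]
  | word v =>
  induction c using induction with
  | zero => simp
  | add a₁ a₂ h₁ h₂ => simp [h₁, h₂]
  | smul c a h => simp [h]
  | word w =>
  simp only [dotMap_ofWord]
  exact sub_eq_zero.1 (mk_eq_zero k (.dot_assoc u v w))

theorem e_dotMap (a : GDNP k X) : dotMap k (ofWord k .e) a = a := by
  induction a using induction with
  | zero => simp
  | add a₁ a₂ h₁ h₂ => simp [h₁, h₂]
  | smul c a h => simp [h]
  | word u =>
  simp only [dotMap_ofWord]
  exact sub_eq_zero.1 (mk_eq_zero k (.e_dot u))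

noncomputable instance : CommRing (GDNP k X) where
  __ := (inferInstance : AddCommGroup (GDNP k X))
  mul a b := dotMap k a b
  one := ofWord k .e
  mul_assoc := dotMap_assoc k
  mul_comm := dotMap_comm k
  one_mul := e_dotMap k
  mul_one a := (dotMap_comm k _ _).trans (e_dotMap k a)
  left_distrib a b c := map_add (dotMap k a) b c
  right_distrib a b c := by
    change dotMap k (a + b) c = dotMap k a c + dotMap k b c
    simp
  zero_mul a := by change dotMap k 0 a = 0; simp
  mul_zero a := by change dotMap k a 0 = 0; simp

theorem mul_def (a b : GDNP k X) : a * b = dotMap k a b := rfl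

theorem one_def : (1 : GDNP k X) = ofWord k .e := rfl

noncomputable instance : Algebra k (GDNP k X) :=
  Algebra.ofModule (fun r a b => by simp [mul_def]) (fun r a b => by simp [mul_def])

noncomputable instance : GDNPoissonAlgebra k (GDNP k X) where
  circ := circMap k
  left_symm a b c := by
    rw [← sub_eq_zero]
    induction a using induction with
    | zero => simp
    | add a₁ a₂ h₁ h₂ =>
      simp only [map_add, LinearMap.add_apply]
      linear_combination (exp := 1) h₁ + h₂
    | smul r a h => simp only [map_smul, LinearMap.smul_apply, ← smul_sub, h, smul_zero]
    | word u =>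
    induction b using induction with
    | zero => simp
    | add a₁ a₂ h₁ h₂ =>
      simp only [map_add, LinearMap.add_apply]
      linear_combination (exp := 1) h₁ + h₂
    | smul r a h => simp only [map_smul, LinearMap.smul_apply, ← smul_sub, h, smul_zero]
    | word v =>
    induction c using induction with
    | zero => simp
    | add a₁ a₂ h₁ h₂ =>
      simp only [map_add]
      linear_combination (exp := 1) h₁ + h₂
    | smul r a h => simp only [map_smul, ← smul_sub, h, smul_zero]
    | word w =>
    simp only [circMap_ofWord]
    exact mk_eq_zero k (.left_symm u v w)
  right_comm a b c := by
    induction a using induction with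
    | zero => simp
    | add a₁ a₂ h₁ h₂ => simp [h₁, h₂]
    | smul c a h => simp [h]
    | word u =>
    induction b using induction with
    | zero => simp
    | add a₁ a₂ h₁ h₂ => simp [h₁, h₂]
    | smul c a h => simp [h]
    | word v =>
    induction c using induction with
    | zero => simp
    | add a₁ a₂ h₁ h₂ => simp [h₁, h₂]
    | smul c a h => simp [h]
    | word w =>
    simp only [circMap_ofWord]
    exact sub_eq_zero.1 (mk_eq_zero k (.right_comm u v w))
  mul_circ a b c := by
    simp only [mul_def]
    induction a using induction with
    | zero => simp
    | add a₁ a₂ h₁ h₂ => simp [h₁, h₂]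
    | smul c a h => simp [h]
    | word u =>
    induction b using induction with
    | zero => simp
    | add a₁ a₂ h₁ h₂ => simp [h₁, h₂]
    | smul c a h => simp [h]
    | word v =>
    induction c using induction with
    | zero => simp
    | add a₁ a₂ h₁ h₂ => simp [h₁, h₂]
    | smul c a h => simp [h]
    | word w =>
    simp only [circMap_ofWord, dotMap_ofWord]
    exact sub_eq_zero.1 (mk_eq_zero k (.dot_circ u v w))
  circ_mul_sub a b c := by
    simp only [mul_def]
    rw [← sub_eq_zero]
    induction a using induction with
    | zero => simp
    | add a₁ a₂ h₁ h₂ =>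
      simp only [map_add, LinearMap.add_apply]
      linear_combination (exp := 1) h₁ + h₂
    | smul r a h => simp only [map_smul, LinearMap.smul_apply, ← smul_sub, h, smul_zero]
    | word u =>
    induction b using induction with
    | zero => simp
    | add a₁ a₂ h₁ h₂ =>
      simp only [map_add, LinearMap.add_apply]
      linear_combination (exp := 1) h₁ + h₂
    | smul r a h => simp only [map_smul, LinearMap.smul_apply, ← smul_sub, h, smul_zero]
    | word v =>
    induction c using induction with
    | zero => simp
    | add a₁ a₂ h₁ h₂ =>
      simp only [map_add]
      linear_combination (exp := 1) h₁ + h₂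
    | smul r a h => simp only [map_smul, ← smul_sub, h, smul_zero]
    | word w =>
    simp only [circMap_ofWord, dotMap_ofWord]
    exact mk_eq_zero k (.circ_dot_sub u v w)

theorem circ_def (a b : GDNP k X) : GDNPoissonAlgebra.circ (k := k) a b = circMap k a b := rfl

/-- The value of a word in a GDN-Poisson algebra. -/
def evalWord {A : Type*} [CommRing A] [Algebra k A] [GDNPoissonAlgebra k A] (f : X → A) :
    GDNPWord X → A
  | .e => 1
  | .of x => f x
  | .dot u v => evalWord f u * evalWord f v
  | .circ u v => GDNPoissonAlgebra.circ (k := k) (evalWord f u) (evalWord f v)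

/-- The universal property: every map from `X` to a GDN-Poisson algebra with unit extends uniquely
to a (unital) homomorphism of GDN-Poisson algebras. -/
theorem existsUnique_lift {A : Type*} [CommRing A] [Algebra k A] [GDNPoissonAlgebra k A]
    (f : X → A) :
    ∃! φ : GDNP k X →ₐ[k] A, (∀ x, φ (ofWord k (.of x)) = f x) ∧
      ∀ a b, φ (GDNPoissonAlgebra.circ (k := k) a b) =
        GDNPoissonAlgebra.circ (k := k) (φ a) (φ b) := by
  have key : ∀ w, Finsupp.lift A k _ (evalWord k f) (Finsupp.single w 1) = evalWord k f w := by
    intro w; simp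
  have hdot : ∀ a b, Finsupp.lift A k _ (evalWord k f) (GDNPWord.bilin k .dot a b) =
      Finsupp.lift A k _ (evalWord k f) a * Finsupp.lift A k _ (evalWord k f) b := by
    intro a b
    have : (GDNPWord.bilin k .dot).compr₂ (Finsupp.lift A k _ (evalWord k f)) =
        (LinearMap.mul k A).compl₁₂ (Finsupp.lift A k _ (evalWord k f))
          (Finsupp.lift A k _ (evalWord k f)) := by
      ext u v
      simp [GDNPWord.bilin_single, evalWord]
    exact LinearMap.congr_fun₂ this a b
  have hcirc : ∀ a b, Finsupp.lift A k _ (evalWord k f) (GDNPWord.bilin k .circ a b) =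
      GDNPoissonAlgebra.circ (k := k) (Finsupp.lift A k _ (evalWord k f) a)
        (Finsupp.lift A k _ (evalWord k f) b) := by
    intro a b
    have : (GDNPWord.bilin k .circ).compr₂ (Finsupp.lift A k _ (evalWord k f)) =
        (GDNPoissonAlgebra.circ (k := k) (A := A)).compl₁₂ (Finsupp.lift A k _ (evalWord k f))
          (Finsupp.lift A k _ (evalWord k f)) := by
      ext u v
      simp [GDNPWord.bilin_single, evalWord]
    exact LinearMap.congr_fun₂ this a b
  have hrel : ∀ r, GDNPWord.Relator k r → Finsupp.lift A k _ (evalWord k f) r = 0 := by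
    intro r hr
    induction hr with
    | dot_comm u v => simp only [map_sub, key, evalWord]; ring
    | dot_assoc u v w => simp only [map_sub, key, evalWord]; ring
    | e_dot u => simp only [map_sub, key, evalWord]; ring
    | left_symm u v w =>
      simp only [map_sub, key, evalWord]
      rw [GDNPoissonAlgebra.left_symm, sub_self]
    | right_comm u v w =>
      simp only [map_sub, key, evalWord]
      rw [GDNPoissonAlgebra.right_comm, sub_self]
    | dot_circ u v w =>
      simp only [map_sub, key, evalWord]
      rw [GDNPoissonAlgebra.mul_circ, sub_self]
    | circ_dot_sub u v w =>
      simp only [map_sub, key, evalWord]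
      rw [GDNPoissonAlgebra.circ_mul_sub, sub_self]
    | dot_left u r _ ih => rw [hdot, ih, mul_zero]
    | dot_right u r _ ih => rw [hdot, ih, zero_mul]
    | circ_left u r _ ih => rw [hcirc, ih, map_zero]
    | circ_right u r _ ih => rw [hcirc, ih, map_zero, LinearMap.zero_apply]
  let L : GDNP k X →ₗ[k] A := (GDNPWord.relIdeal k X).liftQ (Finsupp.lift A k _ (evalWord k f))
    (Submodule.span_le.2 fun r hr => hrel r hr)
  have hL : ∀ r, L (mk k r) = Finsupp.lift A k _ (evalWord k f) r := fun r => rfl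
  refine ⟨AlgHom.ofLinearMap L ?_ ?_, ⟨?_, ?_⟩, ?_⟩
  · exact (hL _).trans (key _)
  · intro a b
    obtain ⟨a, rfl⟩ := Submodule.mkQ_surjective _ a
    obtain ⟨b, rfl⟩ := Submodule.mkQ_surjective _ b
    exact hdot a b
  · intro x
    exact (hL _).trans (key _)
  · intro a b
    obtain ⟨a, rfl⟩ := Submodule.mkQ_surjective _ a
    obtain ⟨b, rfl⟩ := Submodule.mkQ_surjective _ b
    exact hcirc a b
  · rintro ψ ⟨h₁, h₂⟩
    ext a
    change ψ a = L a
    induction a using induction with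
    | zero => simp
    | add a b ha hb => rw [map_add, map_add, ha, hb]
    | smul c a ha => rw [map_smul, map_smul, ha]
    | word w =>
      refine Eq.trans ?_ (key w).symm
      induction w with
      | e => exact map_one ψ
      | of x => exact h₁ x
      | dot u v hu hv => rw [← dotMap_ofWord, ← mul_def, map_mul, hu, hv, evalWord]
      | circ u v hu hv => rw [← circMap_ofWord, ← circ_def, h₂, hu, hv, evalWord]

end GDNP

/-- The word consisting of one letter of `X ∪ {e}`. Here `X ∪ {e}` is `WithBot X`, with `e = ⊥`,
so that `e < x` for all `x` in `X`. -/
def GDNPWord.letter {X : Type*} (a : WithBot X) : GDNPWord X :=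
  WithBot.recBotCoe GDNPWord.e GDNPWord.of a

/-- A row `a_r ∘ (⋯ ∘ (a₃ ∘ (a₂ ∘ a₁)))` with letters in `X ∪ {e}`: `inner` is the innermost letter
`a₁`, and `outer` is the list `[a_r, …, a₃, a₂]`, empty if `r = 1`. -/
structure GDNPRow (X : Type*) where
  outer : List (WithBot X)
  inner : WithBot X

namespace GDNPRow

variable {X : Type*}

/-- The number `r ≥ 1` of letters of a row. -/
def length (A : GDNPRow X) : ℕ := A.outer.length + 1

/-- The row as a word (right-normed bracketing). -/
def word (A : GDNPRow X) : GDNPWord X :=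
  A.outer.foldr (fun a t => (GDNPWord.letter a).circ t) (GDNPWord.letter A.inner)

end GDNPRow

/-- A GDN-Poisson tableau `b₁ ⋯ b_m · ((⋯((a ∘ A₁) ∘ A₂) ∘ ⋯) ∘ A_n)` over `X`, where
`n, m ≥ 0`, the first letter `a` (in the usual notation `a_{1,r₁+1}`) and the letters of the rows
`A₁, …, A_n` belong to `X ∪ {e}`, and `b₁, …, b_m` belong to `X`. -/
structure GDNPTableau (X : Type*) [LinearOrder X] where
  first : WithBot X
  rows : List (GDNPRow X)
  coeff : List X
  /-- The lengths of the rows do not increase, and between rows of equal length the innermost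
  letters do not increase. -/
  rows_sorted : rows.Pairwise fun A B =>
    B.length ≤ A.length ∧ (A.length = B.length → B.inner ≤ A.inner)
  /-- `a_{1,r₁+1} ≥ a_{1,r₁} ≥ ⋯ ≥ a_{1,2} ≥ a_{2,r₂} ≥ ⋯ ≥ a_{2,2} ≥ ⋯ ≥ a_{n,r_n} ≥ ⋯ ≥ a_{n,2}`. -/
  outer_sorted : (first :: rows.flatMap GDNPRow.outer).Pairwise (· ≥ ·)
  /-- `b₁ ≥ ⋯ ≥ b_m`. -/
  coeff_sorted : coeff.Pairwise (· ≥ ·)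
  /-- The last letter of the chain in `outer_sorted` is at least every `b_i`. -/
  coeff_le : ∀ b ∈ coeff,
    (b : WithBot X) ≤ (first :: rows.flatMap GDNPRow.outer).getLast (List.cons_ne_nil _ _)
  /-- If the last letter of the chain in `outer_sorted` is `e`, then `m = 0`. -/
  coeff_eq_nil :
    (first :: rows.flatMap GDNPRow.outer).getLast (List.cons_ne_nil _ _) = ⊥ → coeff = []

namespace GDNPTableau

variable {X : Type*} [LinearOrder X]

/-- The tableau as a word. As `·` is associative and commutative in a GDN-Poisson algebra, the
bracketing of the product `b₁ ⋯ b_m · w` is immaterial. -/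
def word (T : GDNPTableau X) : GDNPWord X :=
  T.coeff.foldr (fun b t => (GDNPWord.of b).dot t)
    (T.rows.foldl (fun t A => t.circ A.word) (GDNPWord.letter T.first))

end GDNPTableau

/-! Put `D y = e ∘ y`. The third identity gives `x ∘ y = x · D y`, and the fourth one at `x = e`
says that `D` is a derivation up to the correction `- a b D(e)`, so that `y ↦ D y - y · D e` is a
derivation. Conversely, a derivation together with an element `ξ` in the role of `D e` always gives
a GDN-Poisson algebra. Hence the free algebra is the polynomial ring in the letters `x` and the jets
`D^(n+1) a` with `a ∈ X ∪ {e}` (`jetEquiv`), and its monomials form a basis.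

Tableaux are then compared with monomials. A tableau has the value `b₁ ⋯ b_m · a · D A₁ ⋯ D A_n`. In
`D (a_r ∘ (⋯ ∘ (a₂ ∘ a₁)))` the term `a_r ⋯ a₂ · D^r a₁` has a single jet of positive order, and all
other terms have the same total order but at least two such jets (`isLeading_row`). So each tableau
equals a leading monomial plus terms of the same total order with more jets of positive order
(`isLeading_tableau`). As the number of these jets is bounded by the total order, the map from
leading monomials to tableaux is the identity plus a locally nilpotent map, hence bijective
(`Module.Basis.bijective_of_unitriangular`).

Finally, each monomial leads exactly one tableau (`lead_injective`, `lead_surjective`). Its jets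
prescribe the lengths and inner letters of the rows; its letters, in nonincreasing order, fill the
outer places; missing letters are made up by `e`, and surplus letters become the `b_i`. -/

namespace GDNPoissonAlgebra

/-! ### GDN-Poisson algebras as commutative algebras with a derivation and a marked element -/

variable (k : Type*) {A : Type*} [Field k] [CommRing A] [Algebra k A]

/-- A commutative algebra with a derivation `δ` and a distinguished element `ξ` is a GDN-Poisson
algebra under `x ∘ y = x (δ y + y ξ)`. -/
noncomputable abbrev ofDerivation (δ : Derivation k A A) (ξ : A) : GDNPoissonAlgebra k A where
  circ := (LinearMap.mul k A).compl₂ (δ.toLinearMap + LinearMap.mulRight k ξ)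
  left_symm x y z := by
    simp [LinearMap.compl₂_apply]; ring
  right_comm x y z := by
    simp [LinearMap.compl₂_apply]; ring
  mul_circ x y z := by
    simp [LinearMap.compl₂_apply]; ring
  circ_mul_sub x y z := by
    simp [LinearMap.compl₂_apply]; ring

variable [GDNPoissonAlgebra k A]

/-- The operator `e ∘ ·`. -/
noncomputable def unitCirc : A →ₗ[k] A := circ 1

theorem circ_eq_mul (a b : A) : circ (k := k) a b = a * unitCirc k b := by
  rw [unitCirc, ← mul_circ, mul_one]

/-- This is `circ_mul_sub` with first argument `e`, rewritten through `circ_eq_mul`. -/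
theorem unitCirc_mul (a b : A) :
    unitCirc k (a * b) = unitCirc k a * b + a * unitCirc k b - a * b * unitCirc k 1 := by
  have h := circ_mul_sub (k := k) 1 a b
  simp only [circ_eq_mul, one_mul] at h
  linear_combination -h

end GDNPoissonAlgebra

/-! ### The free algebra as a polynomial ring in jets -/

namespace GDNP

open GDNPoissonAlgebra MvPolynomial

/-- The polynomial generators of the free GDN-Poisson algebra: `inl x` stands for the letter `x`,
and `inr (n, a)` for the element `e ∘ (⋯ ∘ (e ∘ a))` with `n + 1` letters `e` in front of `a`. -/
abbrev Jet (X : Type*) := X ⊕ (ℕ × WithBot X)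

/-- The polynomial algebra on the jets of the letters. -/
abbrev JetAlgebra (k : Type*) [Field k] (X : Type*) := MvPolynomial (Jet X) k

variable (k : Type*) [Field k] (X : Type*)

/-- The derivation `y ↦ e ∘ y - y · (e ∘ e)` on the jet algebra. -/
noncomputable def jetDerivation : Derivation k (JetAlgebra k X) (JetAlgebra k X) :=
  mkDerivation k (Sum.elim
    (fun x => .X (.inr (0, (x : WithBot X))) - .X (.inl x) * .X (.inr (0, ⊥)))
    (fun j => .X (.inr (j.1 + 1, j.2)) - .X (.inr j) * .X (.inr (0, ⊥))))

noncomputable instance : GDNPoissonAlgebra k (JetAlgebra k X) :=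
  .ofDerivation k (jetDerivation k X) (.X (.inr (0, ⊥)))

variable {X}

theorem unitCirc_jet (p : JetAlgebra k X) :
    unitCirc k p = jetDerivation k X p + p * .X (.inr (0, ⊥)) := by
  change 1 * (jetDerivation k X p + p * .X (.inr (0, ⊥))) = _
  rw [one_mul]

/-- The jet of order `0` of a letter. -/
noncomputable def jetLetter (a : WithBot X) : JetAlgebra k X :=
  WithBot.recBotCoe 1 (fun x => .X (.inl x)) a

theorem unitCirc_jetLetter (a : WithBot X) :
    unitCirc k (jetLetter k a) = .X (.inr (0, a)) := by
  induction a with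
  | bot => simp [unitCirc_jet, jetLetter]
  | coe x => simp [unitCirc_jet, jetLetter, jetDerivation]

theorem unitCirc_inr (j : ℕ × WithBot X) :
    unitCirc k (.X (.inr j) : JetAlgebra k X) = .X (.inr (j.1 + 1, j.2)) := by
  simp [unitCirc_jet, jetDerivation]

/-- The shift by one is forced by `e`: its jet of order `0` is the unit and not a variable, so the
variables indexed by `WithBot X` start at order `1`. -/
theorem iterate_unitCirc_jetLetter (n : ℕ) (a : WithBot X) :
    (unitCirc k)^[n + 1] (jetLetter k a) = .X (.inr (n, a)) := by
  induction n with
  | zero => exact unitCirc_jetLetter k a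
  | succ n ih => rw [Function.iterate_succ_apply', ih, unitCirc_inr]

section Lift

variable {A : Type*} [CommRing A] [Algebra k A] [GDNPoissonAlgebra k A] (f : X → A)

/-- The image of a jet under the map into a GDN-Poisson algebra that is prescribed on `X`. -/
noncomputable def evalJet : Jet X → A :=
  Sum.elim f fun j => (unitCirc k)^[j.1 + 1] (WithBot.recBotCoe 1 f j.2)

/-- Both operators obey the same twisted Leibniz rule `unitCirc_mul`, so it suffices to compare them
on constants and on the variables. -/
theorem aeval_evalJet_unitCirc (p : JetAlgebra k X) :
    aeval (evalJet k f) (unitCirc k p) = unitCirc k (aeval (evalJet k f) p) := by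
  have h1 : aeval (evalJet k f) (.X (.inr (0, ⊥)) : JetAlgebra k X) = unitCirc k (1 : A) := by
    simp [evalJet]
  induction p using MvPolynomial.induction_on with
  | C c =>
    have : (C c : JetAlgebra k X) = c • 1 := MvPolynomial.C_eq_smul_one
    rw [this]
    simp only [map_smul, map_one]
    rw [unitCirc_jet]
    simp [h1]
  | add p q hp hq => simp only [map_add, hp, hq]
  | mul_X p i hp =>
    rw [unitCirc_mul, map_sub, map_add, map_mul, map_mul, map_mul _ p, hp, unitCirc_mul]
    have h2 : aeval (evalJet k f) (unitCirc k (.X i : JetAlgebra k X)) =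
        unitCirc k (aeval (evalJet k f) (.X i : JetAlgebra k X)) := by
      rcases i with x | ⟨n, a⟩
      · have := unitCirc_jetLetter k (x : WithBot X)
        simp only [jetLetter, WithBot.recBotCoe_coe] at this
        rw [this]
        simp [evalJet]
      · rw [unitCirc_inr]
        simp only [aeval_X, evalJet, Sum.elim_inr]
        rw [Function.iterate_succ_apply']
    have h3 : unitCirc k (1 : JetAlgebra k X) = .X (.inr (0, ⊥)) :=
      unitCirc_jetLetter k (⊥ : WithBot X)
    rw [h2, map_mul, h3, h1, map_mul]

theorem aeval_evalJet_circ (p q : JetAlgebra k X) :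
    aeval (evalJet k f) (circ (k := k) p q) =
      circ (k := k) (aeval (evalJet k f) p) (aeval (evalJet k f) q) := by
  rw [circ_eq_mul, circ_eq_mul, map_mul, aeval_evalJet_unitCirc]

end Lift

variable (X) in
/-- The homomorphism from the free GDN-Poisson algebra to the jet algebra. -/
noncomputable def toJet : GDNP k X →ₐ[k] JetAlgebra k X :=
  (existsUnique_lift k fun x : X => (.X (.inl x) : JetAlgebra k X)).choose

theorem toJet_of (x : X) : toJet k X (ofWord k (.of x)) = .X (.inl x) :=
  (existsUnique_lift k fun x : X => (.X (.inl x) : JetAlgebra k X)).choose_spec.1.1 x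

theorem toJet_circ (a b : GDNP k X) :
    toJet k X (circ (k := k) a b) = circ (k := k) (toJet k X a) (toJet k X b) :=
  (existsUnique_lift k fun x : X => (.X (.inl x) : JetAlgebra k X)).choose_spec.1.2 a b

theorem toJet_unitCirc (a : GDNP k X) :
    toJet k X (unitCirc k a) = unitCirc k (toJet k X a) := by
  rw [unitCirc, toJet_circ, map_one, unitCirc]

variable (X) in
/-- The homomorphism from the jet algebra to the free GDN-Poisson algebra. -/
noncomputable def ofJet : JetAlgebra k X →ₐ[k] GDNP k X :=
  aeval (evalJet k fun x => ofWord k (.of x))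

/-- The composite is an endomorphism of the free algebra fixing the letters, so it is the identity
by the uniqueness in the universal property. -/
theorem ofJet_toJet (a : GDNP k X) : ofJet k X (toJet k X a) = a := by
  have h := (existsUnique_lift k fun x : X => ofWord k (.of x)).unique
    (y₁ := (ofJet k X).comp (toJet k X)) (y₂ := AlgHom.id k _) ⟨?_, ?_⟩ ⟨fun _ => rfl, fun _ _ => rfl⟩
  · exact DFunLike.congr_fun h a
  · intro x
    simp [toJet_of, ofJet, evalJet]
  · intro a b
    rw [AlgHom.comp_apply, toJet_circ]
    exact aeval_evalJet_circ k _ _ _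

theorem toJet_ofJet (p : JetAlgebra k X) : toJet k X (ofJet k X p) = p := by
  suffices h : (toJet k X).comp (ofJet k X) = AlgHom.id k _ from DFunLike.congr_fun h p
  refine MvPolynomial.algHom_ext fun i => ?_
  rcases i with x | ⟨n, a⟩
  · simp [ofJet, evalJet, toJet_of]
  · have h : ∀ (n : ℕ) (b : GDNP k X),
        toJet k X ((unitCirc k)^[n] b) = (unitCirc k)^[n] (toJet k X b) := by
      intro n b
      induction n with
      | zero => rfl
      | succ n ih => rw [Function.iterate_succ_apply', toJet_unitCirc, ih,
          Function.iterate_succ_apply']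
    simp only [ofJet, AlgHom.comp_apply, aeval_X, evalJet, Sum.elim_inr, AlgHom.id_apply]
    rw [h, ← iterate_unitCirc_jetLetter]
    congr 1
    induction a with
    | bot => simp [jetLetter]
    | coe x => simp [jetLetter, toJet_of]

variable (X) in
/-- The free GDN-Poisson algebra is the polynomial algebra on the jets of the letters. -/
noncomputable def jetEquiv : GDNP k X ≃ₗ[k] JetAlgebra k X :=
  LinearEquiv.ofLinearMap (toJet k X).toLinearMap (ofJet k X).toLinearMap
    (LinearMap.ext (toJet_ofJet k)) (LinearMap.ext (ofJet_toJet k))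

theorem toJet_ofWord (w : GDNPWord X) :
    toJet k X (ofWord k w) = evalWord k (fun x => .X (.inl x)) w := by
  induction w with
  | e => exact map_one _
  | of x => exact toJet_of k x
  | dot u v hu hv => rw [← dotMap_ofWord, ← mul_def, map_mul, hu, hv, evalWord]
  | circ u v hu hv => rw [← circMap_ofWord, ← circ_def, toJet_circ, hu, hv, evalWord]

theorem evalWord_letter (a : WithBot X) :
    evalWord k (fun x => .X (.inl x)) (GDNPWord.letter a) = jetLetter k a := by
  induction a <;> rfl

end GDNP

/-! ### Combinatorics: tableaux and monomials -/

namespace GDNPRow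

variable {X : Type*}

/-- The number of outer letters of a row together with its innermost letter. -/
def key (A : GDNPRow X) : ℕ × WithBot X := (A.outer.length, A.inner)

theorem length_flatMap_outer (l : List (GDNPRow X)) :
    (l.flatMap outer).length = ((l.map key).map Prod.fst).sum := by
  rw [List.length_flatMap, List.map_map]
  rfl

/-- The keys prescribe the lengths of the pieces, so the concatenated outer letters can be cut in
only one way. -/
theorem eq_of_map_key_eq {l l' : List (GDNPRow X)} (hk : l.map key = l'.map key)
    (ho : l.flatMap outer = l'.flatMap outer) : l = l' := by
  induction l generalizing l' with
  | nil =>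
    cases l' with
    | nil => rfl
    | cons B l' => simp at hk
  | cons A l ih =>
    cases l' with
    | nil => simp at hk
    | cons B l' =>
      obtain ⟨oA, iA⟩ := A
      obtain ⟨oB, iB⟩ := B
      simp only [List.map_cons, List.cons.injEq, key, Prod.mk.injEq] at hk
      simp only [List.flatMap_cons] at ho
      obtain ⟨h1, h2⟩ := List.append_inj ho hk.1.1
      rw [h1, hk.1.2, ih hk.2 h2]

theorem exists_map_key_eq (K : List (ℕ × WithBot X)) (l : List (WithBot X))
    (hl : l.length = (K.map Prod.fst).sum) :
    ∃ R : List (GDNPRow X), R.map key = K ∧ R.flatMap outer = l := by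
  induction K generalizing l with
  | nil => exact ⟨[], rfl, (List.eq_nil_of_length_eq_zero hl).symm⟩
  | cons z K ih =>
    simp only [List.map_cons, List.sum_cons] at hl
    obtain ⟨R, h1, h2⟩ := ih (l.drop z.1) (by simp [hl])
    refine ⟨⟨l.take z.1, z.2⟩ :: R, ?_, ?_⟩
    · simp [h1, key, hl]
    · simp [h2]

end GDNPRow

namespace WithBot

variable {X : Type*}

/-- The entries different from `⊥` of a list. -/
def unbotList (l : List (WithBot X)) : List X := l.flatMap (recBotCoe [] fun x => [x])

@[simp]
theorem unbotList_bot_cons (l : List (WithBot X)) : unbotList (⊥ :: l) = unbotList l := rfl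

@[simp]
theorem unbotList_coe_cons (x : X) (l : List (WithBot X)) :
    unbotList ((x : WithBot X) :: l) = x :: unbotList l := rfl

theorem unbotList_append (l l' : List (WithBot X)) :
    unbotList (l ++ l') = unbotList l ++ unbotList l' := List.flatMap_append

theorem unbotList_map_coe (l : List X) : unbotList (l.map ((↑) : X → WithBot X)) = l := by
  induction l with
  | nil => rfl
  | cons a l ih => rw [List.map_cons, unbotList_coe_cons, ih]

theorem unbotList_replicate_bot (n : ℕ) :
    unbotList (List.replicate n (⊥ : WithBot X)) = [] := by
  induction n with
  | zero => rfl
  | succ n ih => rw [List.replicate_succ, unbotList_bot_cons, ih]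

variable [DecidableEq X]

theorem length_unbotList_add_count_bot (l : List (WithBot X)) :
    (unbotList l).length + l.count ⊥ = l.length := by
  induction l with
  | nil => rfl
  | cons a l ih =>
    induction a with
    | bot => rw [List.count_cons_self, List.length_cons, ← ih, unbotList_bot_cons]; omega
    | coe x =>
      rw [List.count_cons_of_ne (by simp), List.length_cons, ← ih, unbotList_coe_cons,
        List.length_cons]
      omega

theorem count_unbotList (x : X) (l : List (WithBot X)) :
    (unbotList l).count x = l.count (x : WithBot X) := by
  induction l with
  | nil => rfl
  | cons a l ih =>
    induction a with
    | bot => rw [List.count_cons_of_ne (by simp), ← ih, unbotList_bot_cons]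
    | coe y =>
      rw [unbotList_coe_cons, List.count_cons, List.count_cons, ih]
      simp

end WithBot

namespace GDNPTableau

variable {X : Type*} [LinearOrder X]

/-- The chain of outer letters of a tableau. -/
def chain (T : GDNPTableau X) : List (WithBot X) := T.first :: T.rows.flatMap GDNPRow.outer

/-- The letters of `X` at the places `b_i` and at the outer places of a tableau. -/
def outerLetters (T : GDNPTableau X) : Multiset X :=
  (WithBot.unbotList T.chain : Multiset X) + (T.coeff : Multiset X)

/-- The exponent of the leading monomial of a tableau. -/
def lead (T : GDNPTableau X) : Multiset X × Multiset (ℕ × WithBot X) :=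
  (T.outerLetters, ((T.rows.map GDNPRow.key : List _) : Multiset _))

/-- The nonincreasing list of all outer letters, followed by the letters `b_i`. -/
def letters (T : GDNPTableau X) : List (WithBot X) := T.chain ++ T.coeff.map (↑)

theorem ge_getLast_of_mem_chain (T : GDNPTableau X) {a : WithBot X} (ha : a ∈ T.chain) :
    T.chain.getLast (List.cons_ne_nil _ _) ≤ a := by
  have hne : T.chain ≠ [] := List.cons_ne_nil _ _
  have h : T.chain.Pairwise (· ≥ ·) := T.outer_sorted
  rw [← List.dropLast_append_getLast hne, List.pairwise_append] at h
  rw [← List.dropLast_append_getLast hne, List.mem_append] at ha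
  rcases ha with ha | ha
  · exact h.2.2 a ha _ (List.mem_singleton.2 rfl)
  · exact (List.mem_singleton.1 ha).symm.le

theorem letters_sorted (T : GDNPTableau X) : T.letters.Pairwise (· ≥ ·) := by
  refine List.pairwise_append.2 ⟨T.outer_sorted, ?_, ?_⟩
  · exact List.pairwise_map.2 (T.coeff_sorted.imp fun h => WithBot.coe_le_coe.2 h)
  · intro a ha b hb
    obtain ⟨b, hb', rfl⟩ := List.mem_map.1 hb
    exact (T.coeff_le b hb').trans (T.ge_getLast_of_mem_chain ha)

/-- Condition (1) is the lexicographic order on the keys, so the list of keys is determined by its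
multiset. -/
theorem rows_key_sorted (T : GDNPTableau X) :
    ((T.rows.map GDNPRow.key).map toLex).Pairwise (· ≥ ·) := by
  rw [List.map_map, List.pairwise_map]
  refine T.rows_sorted.imp fun {A B} h => ?_
  simp only [ge_iff_le, Prod.Lex.le_iff]
  obtain ⟨h1, h2⟩ := h
  simp only [GDNPRow.length] at h1 h2
  rcases (Nat.add_le_add_iff_right.1 h1).lt_or_eq with h | h
  · exact Or.inl h
  · exact Or.inr ⟨h, h2 (by omega)⟩

theorem unbotList_letters (T : GDNPTableau X) :
    (WithBot.unbotList T.letters : Multiset X) = T.outerLetters := by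
  rw [letters, WithBot.unbotList_append, WithBot.unbotList_map_coe]
  rfl

theorem bot_notMem_chain (T : GDNPTableau X) (h : T.coeff ≠ []) : ⊥ ∉ T.chain := fun hb =>
  h (T.coeff_eq_nil (le_bot_iff.1 (T.ge_getLast_of_mem_chain hb)))

theorem length_chain (T : GDNPTableau X) :
    T.chain.length = ((T.rows.map GDNPRow.key).map Prod.fst).sum + 1 := by
  rw [chain, List.length_cons, GDNPRow.length_flatMap_outer]

/-- Recovers the number of `e`, which the leading monomial does not show. Without `b_i` the letters
are the chain itself; with some `b_i` no `e` occurs, and the truncated subtraction gives `0`. -/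
theorem count_bot_letters (T : GDNPTableau X) :
    T.letters.count ⊥ = T.chain.length - T.outerLetters.card := by
  have h := WithBot.length_unbotList_add_count_bot T.letters
  rw [← unbotList_letters, Multiset.coe_card]
  by_cases hc : T.coeff = []
  · simp only [letters, hc, List.map_nil, List.append_nil] at h ⊢
    omega
  · have h0 : T.letters.count ⊥ = 0 := by
      rw [List.count_eq_zero]
      simp [letters, T.bot_notMem_chain hc]
    have hl : T.chain.length ≤ T.letters.length := by simp [letters]
    omega

/-- The sorted keys give the length of the chain, hence the number of `e`, hence the sorted list of
all letters. Cutting it after the chain separates the `b_i`, and the keys cut the chain into rows.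
-/
theorem lead_injective : Function.Injective (lead (X := X)) := by
  intro T T' h
  obtain ⟨h1, h2⟩ := Prod.mk.inj h
  have hk : T.rows.map GDNPRow.key = T'.rows.map GDNPRow.key := by
    have := (List.Perm.eq_of_pairwise' T.rows_key_sorted T'.rows_key_sorted
      ((Multiset.coe_eq_coe.1 h2).map _))
    exact List.map_injective_iff.2 toLex.injective this
  have hlen : T.chain.length = T'.chain.length := by rw [length_chain, length_chain, hk]
  have hl : T.letters = T'.letters := by
    refine List.Perm.eq_of_pairwise' T.letters_sorted T'.letters_sorted ?_
    rw [List.perm_iff_count]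
    intro a
    induction a with
    | bot => rw [count_bot_letters, count_bot_letters, hlen, h1]
    | coe x =>
      rw [← WithBot.count_unbotList, ← WithBot.count_unbotList, ← Multiset.coe_count,
        ← Multiset.coe_count, unbotList_letters, unbotList_letters, h1]
  obtain ⟨hc, hb⟩ := List.append_inj hl hlen
  have hb := List.map_injective_iff.2 WithBot.coe_injective hb
  obtain ⟨hf, ho⟩ := List.cons.inj hc
  have hr := GDNPRow.eq_of_map_key_eq hk ho
  cases T
  cases T'
  simp_all

theorem lead_surjective : Function.Surjective (lead (X := X)) := by
  rintro ⟨y, z⟩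
  obtain ⟨Y, hY, rfl⟩ : ∃ Y : List X, Y.Pairwise (· ≥ ·) ∧ (Y : Multiset X) = y :=
    ⟨y.sort (· ≥ ·), y.pairwise_sort _, y.sort_eq _⟩
  obtain ⟨K, hK, rfl⟩ : ∃ K : List (ℕ × WithBot X),
      (K.map toLex).Pairwise (· ≥ ·) ∧ (K : Multiset _) = z := by
    refine ⟨((z.map toLex).sort (· ≥ ·)).map ofLex, ?_, ?_⟩
    · rw [List.map_map]
      exact (List.map_id _).symm ▸ (z.map toLex).pairwise_sort (· ≥ ·)
    · rw [← Multiset.map_coe, Multiset.sort_eq, Multiset.map_map]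
      exact Multiset.map_id z
  -- The number of places in the chain; the extra one is for the first letter.
  set N := (K.map Prod.fst).sum + 1 with hN
  have hlen : ((Y.take N).map ((↑) : X → WithBot X) ++
      List.replicate (N - Y.length) ⊥).length = N := by
    simp; omega
  obtain ⟨a, l, hal⟩ : ∃ a l, (Y.take N).map ((↑) : X → WithBot X) ++
      List.replicate (N - Y.length) ⊥ = a :: l :=
    List.exists_cons_of_length_eq_add_one hlen
  obtain ⟨R, hRk, hRo⟩ := GDNPRow.exists_map_key_eq K l (by
    rw [hal] at hlen; simp at hlen; omega)
  have hYs : (Y.take N).Pairwise (· ≥ ·) ∧ (Y.drop N).Pairwise (· ≥ ·) ∧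
      ∀ a ∈ Y.take N, ∀ b ∈ Y.drop N, a ≥ b := by
    rw [← List.pairwise_append, List.take_append_drop]; exact hY
  have hchain : a :: R.flatMap GDNPRow.outer = (Y.take N).map ((↑) : X → WithBot X) ++
      List.replicate (N - Y.length) ⊥ := by rw [hRo, hal]
  -- If some `b_i` is left over, the letters exhaust the chain and no `e` was needed; this yields
  -- condition (3).
  have hdrop : Y.drop N ≠ [] → a :: R.flatMap GDNPRow.outer = (Y.take N).map (↑) := by
    intro h
    have : N - Y.length = 0 := by
      have := List.length_pos_iff.2 h
      rw [List.length_drop] at this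
      omega
    rw [hchain, this]; simp
  refine ⟨⟨a, R, Y.drop N, ?_, ?_, hYs.2.1, ?_, ?_⟩, ?_⟩
  · rw [← hRk, List.map_map, List.pairwise_map] at hK
    refine hK.imp fun {A B} h => ?_
    simp only [ge_iff_le, Prod.Lex.le_iff, Function.comp_apply, ofLex_toLex, GDNPRow.key] at h
    simp only [GDNPRow.length]
    refine ⟨by rcases h with h | h <;> omega, fun h' => ?_⟩
    rcases h with h | h
    · omega
    · exact h.2
  · rw [hchain, List.pairwise_append, List.pairwise_map]
    refine ⟨hYs.1.imp fun h => WithBot.coe_le_coe.2 h, List.pairwise_replicate.2 (Or.inr le_rfl),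
      fun a _ b hb => ?_⟩
    rw [List.eq_of_mem_replicate hb]
    exact bot_le
  · intro b hb
    have hmem := List.getLast_mem (List.cons_ne_nil a (R.flatMap GDNPRow.outer))
    generalize List.getLast _ _ = c at hmem
    rw [hdrop (List.ne_nil_of_mem hb)] at hmem
    obtain ⟨c, hc, rfl⟩ := List.mem_map.1 hmem
    exact WithBot.coe_le_coe.2 (hYs.2.2 c hc b hb)
  · intro hbot
    by_contra h
    have hmem := List.getLast_mem (List.cons_ne_nil a (R.flatMap GDNPRow.outer))
    rw [hbot, hdrop h] at hmem
    obtain ⟨x, -, hx⟩ := List.mem_map.1 hmem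
    exact WithBot.coe_ne_bot hx
  · refine Prod.ext ?_ ?_
    · simp only [lead, outerLetters, chain]
      rw [hchain, WithBot.unbotList_append, WithBot.unbotList_map_coe]
      rw [WithBot.unbotList_replicate_bot, List.append_nil, Multiset.coe_add, List.take_append_drop]
    · simp only [lead, hRk]

/-- Tableaux correspond to monomials. -/
noncomputable def leadEquiv : GDNPTableau X ≃ Multiset X × Multiset (ℕ × WithBot X) :=
  Equiv.ofBijective lead ⟨lead_injective, lead_surjective⟩

end GDNPTableau

/-! ### Unitriangular endomorphisms -/

/-- An endomorphism that is unitriangular with respect to a grading `w` and a filtration `d` which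
is bounded by the grading is bijective. -/
theorem Module.Basis.bijective_of_unitriangular {k V ι : Type*} [Field k] [AddCommGroup V]
    [Module k V] (B : Module.Basis ι k V) (θ : V →ₗ[k] V) (w d : ι → ℕ) (hdw : ∀ i, d i ≤ w i)
    (h : ∀ i, θ (B i) - B i ∈ Submodule.span k (B '' {j | w j = w i ∧ d i + 1 ≤ d j})) :
    Function.Bijective θ := by
  set N : V →ₗ[k] V := θ - LinearMap.id with hN
  have hNθ : ∀ v, θ v = v + N v := fun v => by simp [hN]
  let F : ℕ → ℕ → Submodule k V := fun a n => Submodule.span k (B '' {j | w j = a ∧ n ≤ d j})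
  have hF : ∀ a n v, v ∈ F a n → N v ∈ F a (n + 1) := by
    intro a n
    suffices F a n ≤ (F a (n + 1)).comap N from fun v hv => this hv
    refine Submodule.span_le.2 ?_
    rintro _ ⟨j, ⟨rfl, hj⟩, rfl⟩
    refine Submodule.span_mono (Set.image_mono ?_) (h j)
    rintro i ⟨hi, hi'⟩
    exact ⟨hi, by omega⟩
  have hpow : ∀ i m, (N ^ m) (B i) ∈ F (w i) m := by
    intro i m
    induction m with
    | zero => exact Submodule.subset_span ⟨i, ⟨rfl, Nat.zero_le _⟩, rfl⟩
    | succ m ih => rw [pow_succ', Module.End.mul_apply]; exact hF _ _ _ ih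
  -- Each application of `N` raises `d` by at least one and keeps `w`, while `d ≤ w`; so `N ^ (w i +
  -- 1)` kills `B i`.
  have hnil : ∀ v, ∃ m, (N ^ m) v = 0 := by
    intro v
    induction B.mem_span v using Submodule.span_induction with
    | mem x hx =>
      obtain ⟨i, rfl⟩ := hx
      refine ⟨w i + 1, ?_⟩
      have he : {j | w j = w i ∧ w i + 1 ≤ d j} = ∅ := by
        ext j
        simp only [Set.mem_ofPred_eq, Set.mem_empty_iff_false, iff_false]
        have := hdw j
        omega
      have hi := hpow i (w i + 1)
      simp only [F, he, Set.image_empty, Submodule.span_empty] at hi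
      exact (Submodule.mem_bot k).1 hi
    | zero => exact ⟨0, by simp⟩
    | add x y _ _ hx hy =>
      obtain ⟨m, hm⟩ := hx
      obtain ⟨n, hn⟩ := hy
      refine ⟨m + n, ?_⟩
      rw [map_add, pow_add, Module.End.mul_apply, Module.End.mul_apply, hn, map_zero, add_zero,
        ← Module.End.mul_apply, ← pow_add, add_comm, pow_add, Module.End.mul_apply, hm, map_zero]
    | smul c x _ hx =>
      obtain ⟨m, hm⟩ := hx
      exact ⟨m, by rw [map_smul, hm, smul_zero]⟩
  constructor
  · rw [← LinearMap.ker_eq_bot, LinearMap.ker_eq_bot']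
    intro v hv
    obtain ⟨m, hm⟩ := hnil v
    -- On the kernel `N` acts as `-1`, so a power of `N` killing `v` forces `v = 0`.
    have hv' : N v = -v := by
      rw [hNθ] at hv
      exact (neg_eq_of_add_eq_zero_right hv).symm
    induction m with
    | zero => exact hm
    | succ m ih =>
      rw [pow_succ, Module.End.mul_apply, hv', map_neg, neg_eq_zero] at hm
      exact ih hm
  · intro v
    obtain ⟨m, hm⟩ := hnil v
    induction m generalizing v with
    | zero => exact ⟨0, by rw [map_zero]; exact hm.symm⟩
    | succ m ih =>
      rw [pow_succ, Module.End.mul_apply] at hm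
      obtain ⟨u, hu⟩ := ih _ hm
      -- By induction `N v = θ u`, and `θ v = v + N v`, so `θ (v - u) = v`.
      exact ⟨v - u, by rw [map_sub, hu, hNθ]; simp⟩

/-! ### The filtration by the number of jets of positive order -/

namespace GDNP

open GDNPoissonAlgebra MvPolynomial

variable (k : Type*) [Field k] {X : Type*}

/-- The number of letters `e ∘ ·` in front of a jet. -/
def jetOrder : Jet X → ℕ := Sum.elim (fun _ => 0) fun j => j.1 + 1

/-- The indicator of the jets of positive order. -/
def jetPos : Jet X → ℕ := Sum.elim (fun _ => 0) fun _ => 1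

theorem weight_jetPos_le (m : Jet X →₀ ℕ) :
    Finsupp.weight jetPos m ≤ Finsupp.weight jetOrder m := by
  rw [Finsupp.weight_apply, Finsupp.weight_apply]
  refine Finset.sum_le_sum fun i _ => ?_
  refine Nat.mul_le_mul_left _ ?_
  rcases i with x | j <;> simp [jetPos, jetOrder]

theorem weight_jetOrder_eq_zero {m : Jet X →₀ ℕ} (h : Finsupp.weight jetPos m = 0) :
    Finsupp.weight jetOrder m = 0 := by
  rw [Finsupp.weight_apply, Finsupp.sum, Finset.sum_eq_zero_iff] at h ⊢
  intro i hi
  have := h i hi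
  rcases i with x | j
  · simp [jetOrder]
  · simp [jetPos] at this
    simp [this]

variable (X) in
/-- The polynomials of total order `w` in the jets all of whose monomials have at least `d` factors
of positive order. -/
noncomputable def jetFiltration (w d : ℕ) : Submodule k (JetAlgebra k X) :=
  restrictSupport k {m | Finsupp.weight jetOrder m = w ∧ d ≤ Finsupp.weight jetPos m}

variable {k} {w w' d d' : ℕ} {p p' q q' : JetAlgebra k X}

theorem jetFiltration_mono (h : d' ≤ d) (hp : p ∈ jetFiltration k X w d) :
    p ∈ jetFiltration k X w d' :=
  restrictSupport_mono k (fun _ hm => And.intro hm.1 (h.trans hm.2)) hp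

/-- A monomial of positive total order has at least one factor of positive order. -/
theorem mem_jetFiltration_one (hp : p ∈ jetFiltration k X (w + 1) d) :
    p ∈ jetFiltration k X (w + 1) 1 := by
  refine restrictSupport_mono k (fun m hm => And.intro hm.1 ?_) hp
  by_contra h
  have h1 := weight_jetOrder_eq_zero (m := m) (by omega)
  have h2 := hm.1
  omega

theorem monomial_mem_jetFiltration (m : Jet X →₀ ℕ) (c : k) :
    monomial m c ∈ jetFiltration k X (Finsupp.weight jetOrder m) (Finsupp.weight jetPos m) :=
  (monomial_mem_restrictSupport k).2 (Or.inl ⟨rfl, le_rfl⟩)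

/-- Both weights are additive in the exponent. The target indices `v`, `c` are left free, and the
default `omega` matches them with the sums. -/
theorem mul_mem_jetFiltration {v c : ℕ} (hp : p ∈ jetFiltration k X w d)
    (hp' : p' ∈ jetFiltration k X w' d') (hv : v = w + w' := by omega)
    (hc : c ≤ d + d' := by omega) : p * p' ∈ jetFiltration k X v c := by
  have h := Submodule.mul_mem_mul hp hp'
  rw [jetFiltration, jetFiltration, ← restrictSupport_add] at h
  refine restrictSupport_mono k ?_ h
  rintro _ ⟨m, ⟨hm, hm'⟩, n, ⟨hn, hn'⟩, rfl⟩
  simp only [Set.mem_ofPred_eq, map_add]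
  omega

theorem weight_eq_of_monomial_mem {m : Jet X →₀ ℕ}
    (h : (monomial m 1 : JetAlgebra k X) ∈ jetFiltration k X w d) :
    Finsupp.weight jetOrder m = w :=
  (((monomial_mem_restrictSupport k).1 h).resolve_right one_ne_zero).1

theorem jetFiltration_eq_span (w d : ℕ) : jetFiltration k X w d = Submodule.span k
    ((monomial · 1) '' {m | Finsupp.weight jetOrder m = w ∧ d ≤ Finsupp.weight jetPos m}) :=
  restrictSupport_eq_span k _

attribute [irreducible] jetFiltration

theorem X_mem_jetFiltration (i : Jet X) :
    (.X i : JetAlgebra k X) ∈ jetFiltration k X (jetOrder i) (jetPos i) := by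
  have h := monomial_mem_jetFiltration (k := k) (Finsupp.single i 1) 1
  rwa [Finsupp.weight_single, Finsupp.weight_single, one_smul, one_smul] at h

theorem X_inl_mem_jetFiltration (x : X) :
    (.X (.inl x) : JetAlgebra k X) ∈ jetFiltration k X 0 0 :=
  X_mem_jetFiltration (.inl x)

theorem X_inr_mem_jetFiltration (n : ℕ) (a : WithBot X) :
    (.X (.inr (n, a)) : JetAlgebra k X) ∈ jetFiltration k X (n + 1) 1 :=
  X_mem_jetFiltration (.inr (n, a))

theorem one_mem_jetFiltration : (1 : JetAlgebra k X) ∈ jetFiltration k X 0 0 := by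
  simpa using monomial_mem_jetFiltration (k := k) (0 : Jet X →₀ ℕ) 1

theorem jetLetter_mem_jetFiltration (a : WithBot X) : jetLetter k a ∈ jetFiltration k X 0 0 := by
  induction a with
  | bot => exact one_mem_jetFiltration
  | coe x => exact X_inl_mem_jetFiltration x

theorem prod_mem_jetFiltration_zero {l : List (JetAlgebra k X)}
    (h : ∀ p ∈ l, p ∈ jetFiltration k X 0 0) : l.prod ∈ jetFiltration k X 0 0 := by
  induction l with
  | nil => exact one_mem_jetFiltration
  | cons p l ih =>
    rw [List.prod_cons]
    exact mul_mem_jetFiltration (h p (by simp)) (ih fun q hq => h q (by simp [hq]))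

/-- Multiplication by `ξ = D e` adds a factor of order one. The derivation replaces one factor of a
monomial by its derivative, which raises the order by one and never loses a jet of positive order.
-/
theorem unitCirc_mem_jetFiltration (hp : p ∈ jetFiltration k X w d) :
    unitCirc k p ∈ jetFiltration k X (w + 1) d := by
  have hξ : (.X (.inr (0, ⊥)) : JetAlgebra k X) ∈ jetFiltration k X 1 1 := X_inr_mem_jetFiltration 0 ⊥
  rw [unitCirc_jet]
  refine Submodule.add_mem _ ?_ (mul_mem_jetFiltration hp hξ)
  suffices jetFiltration k X w d ≤
    (jetFiltration k X (w + 1) d).comap (jetDerivation k X).toLinearMap from this hp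
  rw [jetFiltration_eq_span, Submodule.span_le]
  rintro _ ⟨m, ⟨rfl, hm⟩, rfl⟩
  change jetDerivation k X (monomial m 1) ∈ jetFiltration k X (Finsupp.weight jetOrder m + 1) d
  refine jetFiltration_mono hm ?_
  rw [jetDerivation, mkDerivation_monomial, one_smul]
  refine Submodule.sum_mem _ fun i hi => ?_
  -- Split off the factor that is differentiated.
  have hmi : m = (m - Finsupp.single i 1) + Finsupp.single i 1 := by
    rw [tsub_add_cancel_of_le]
    exact Finsupp.single_le_iff.2 (Nat.one_le_iff_ne_zero.2 (Finsupp.mem_support_iff.1 hi))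
  have h1 : Finsupp.weight jetOrder m + 1 =
      Finsupp.weight jetOrder (m - Finsupp.single i 1) + (jetOrder i + 1) := by
    conv_lhs => rw [hmi, map_add, Finsupp.weight_single, one_smul]
    ring
  have h2 : Finsupp.weight jetPos m =
      Finsupp.weight jetPos (m - Finsupp.single i 1) + jetPos i := by
    conv_lhs => rw [hmi, map_add, Finsupp.weight_single, one_smul]
  rw [h1, h2]
  refine mul_mem_jetFiltration (w' := jetOrder i + 1) (d' := jetPos i)
    (monomial_mem_jetFiltration _ _) ?_
  have hiξ : (.X i * .X (.inr (0, ⊥)) : JetAlgebra k X) ∈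
      jetFiltration k X (jetOrder i + 1) (jetPos i) :=
    mul_mem_jetFiltration (X_mem_jetFiltration i) hξ
  rcases i with x | j
  · exact Submodule.sub_mem _ (jetFiltration_mono (Nat.zero_le 1) (X_inr_mem_jetFiltration 0 _)) hiξ
  · exact Submodule.sub_mem _ (X_inr_mem_jetFiltration (j.1 + 1) j.2) hiξ

/-! ### Leading parts of rows -/

/-- `q` belongs to `jetFiltration k X w d` and is the part of `p` of lowest filtration. -/
def IsLeading (w d : ℕ) (p q : JetAlgebra k X) : Prop :=
  q ∈ jetFiltration k X w d ∧ p - q ∈ jetFiltration k X w (d + 1)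

theorem IsLeading.refl (hp : p ∈ jetFiltration k X w d) : IsLeading w d p p :=
  ⟨hp, by rw [sub_self]; exact zero_mem _⟩

theorem IsLeading.mem (h : IsLeading w d p q) : p ∈ jetFiltration k X w d := by
  rw [← sub_add_cancel p q]
  exact Submodule.add_mem _ (jetFiltration_mono (Nat.le_succ d) h.2) h.1

theorem IsLeading.mul (h : IsLeading w d p q) (h' : IsLeading w' d' p' q') :
    IsLeading (w + w') (d + d') (p * p') (q * q') := by
  refine ⟨mul_mem_jetFiltration h.1 h'.1, ?_⟩
  have e : p * p' - q * q' = (p - q) * p' + q * (p' - q') := by ring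
  rw [e]
  refine Submodule.add_mem _ ?_ (mul_mem_jetFiltration h.1 h'.2)
  exact mul_mem_jetFiltration h.2 h'.mem

/-- The value of a word in the jet algebra. -/
noncomputable abbrev jetWord (k : Type*) [Field k] (u : GDNPWord X) : JetAlgebra k X :=
  evalWord k (fun x => .X (.inl x)) u

theorem jetWord_circ (u v : GDNPWord X) :
    jetWord k (u.circ v) = jetWord k u * unitCirc k (jetWord k v) :=
  circ_eq_mul k _ _

/-- The leading monomial of `e ∘ A` for a row `A`. -/
noncomputable def rowLead (k : Type*) [Field k] (A : GDNPRow X) : JetAlgebra k X :=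
  (A.outer.map (jetLetter k)).prod * .X (.inr A.key)

/-- Prefixing an outer letter `b` turns `v = D A` into `D (b v) = D b · v + b · D v - b v ξ`. The
outer two terms have at least two jets of positive order. If `v` has leading part `u x`, with `u`
the product of the outer letters and `x` a jet, then in `D (u x)` only `u · D x` keeps a single such
jet. -/
theorem isLeading_row (A : GDNPRow X) :
    IsLeading (A.key.1 + 1) 1 (unitCirc k (jetWord k A.word)) (rowLead k A) := by
  obtain ⟨l, a⟩ := A
  induction l with
  | nil =>
    simp only [rowLead, GDNPRow.key, GDNPRow.word, List.foldr_nil, jetWord, evalWord_letter,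
      List.map_nil, List.prod_nil, one_mul, List.length_nil]
    rw [unitCirc_jetLetter]
    exact .refl (X_inr_mem_jetFiltration 0 a)
  | cons b l ih =>
    have hξ : (.X (.inr (0, ⊥)) : JetAlgebra k X) ∈ jetFiltration k X 1 1 := X_inr_mem_jetFiltration 0 ⊥
    have h1 : unitCirc k (1 : JetAlgebra k X) = .X (.inr (0, ⊥)) :=
      unitCirc_jetLetter k (⊥ : WithBot X)
    have hw : jetWord k (GDNPRow.word ⟨b :: l, a⟩) =
        jetLetter k b * unitCirc k (jetWord k (GDNPRow.word ⟨l, a⟩)) := by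
      rw [← evalWord_letter]
      exact jetWord_circ _ _
    rw [hw]
    have hb := jetLetter_mem_jetFiltration (k := k) b
    have hDb := mem_jetFiltration_one (unitCirc_mem_jetFiltration hb)
    have hu : (l.map (jetLetter k)).prod ∈ jetFiltration k X 0 0 := by
      refine prod_mem_jetFiltration_zero fun p hp => ?_
      obtain ⟨c, -, rfl⟩ := List.mem_map.1 hp
      exact jetLetter_mem_jetFiltration c
    have hDu := mem_jetFiltration_one (unitCirc_mem_jetFiltration hu)
    have hx : (.X (.inr (l.length, a)) : JetAlgebra k X) ∈ jetFiltration k X (l.length + 1) 1 :=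
      X_inr_mem_jetFiltration _ a
    have hx' := X_inr_mem_jetFiltration (k := k) (l.length + 1) a
    have hv := ih.mem
    have hg := unitCirc_mem_jetFiltration ih.2
    simp only [rowLead, GDNPRow.key, List.map_cons, List.prod_cons, List.length_cons] at *
    generalize unitCirc k (jetWord k (GDNPRow.word ⟨l, a⟩)) = v at *
    generalize (l.map (jetLetter k)).prod = u at *
    refine ⟨?_, ?_⟩
    · exact mul_mem_jetFiltration (mul_mem_jetFiltration (v := 0) (c := 0) hb hu) hx'
    · rw [map_sub, unitCirc_mul k u, unitCirc_inr, h1] at hg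
      rw [unitCirc_mul, h1]
      -- The remainder is regrouped so that every summand visibly has two factors of positive order;
      -- the inner parenthesis is `D` of the remainder for the shorter row.
      have e : unitCirc k (jetLetter k b) * v + jetLetter k b * unitCirc k v -
          jetLetter k b * v * MvPolynomial.X (.inr (0, ⊥)) - jetLetter k b * u * MvPolynomial.X (.inr (l.length + 1, a)) =
        unitCirc k (jetLetter k b) * v - jetLetter k b * (v * MvPolynomial.X (.inr (0, ⊥))) +
        jetLetter k b * ((unitCirc k v - (unitCirc k u * MvPolynomial.X (.inr (l.length, a)) +
          u * MvPolynomial.X (.inr (l.length + 1, a)) - u * MvPolynomial.X (.inr (l.length, a)) * MvPolynomial.X (.inr (0, ⊥)))) +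
          unitCirc k u * MvPolynomial.X (.inr (l.length, a)) -
          u * (MvPolynomial.X (.inr (l.length, a)) * MvPolynomial.X (.inr (0, ⊥)))) := by ring
      rw [e]
      refine Submodule.add_mem _ (Submodule.sub_mem _ (mul_mem_jetFiltration hDb hv)
        (mul_mem_jetFiltration hb (mul_mem_jetFiltration (v := l.length + 2) (c := 2) hv hξ)))
        (mul_mem_jetFiltration (w' := l.length + 2) (d' := 2) hb ?_)
      exact Submodule.sub_mem _ (Submodule.add_mem _ hg (mul_mem_jetFiltration hDu hx))
        (mul_mem_jetFiltration hu (mul_mem_jetFiltration (v := l.length + 2) (c := 2) hx hξ))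

theorem isLeading_rows (l : List (GDNPRow X)) :
    IsLeading ((l.map fun A => A.key.1 + 1).sum) l.length
      (l.map fun A => unitCirc k (jetWord k A.word)).prod (l.map (rowLead k)).prod := by
  induction l with
  | nil => exact .refl one_mem_jetFiltration
  | cons A l ih =>
    simp only [List.map_cons, List.prod_cons, List.sum_cons, List.length_cons]
    rw [add_comm l.length]
    exact (isLeading_row A).mul ih

theorem jetWord_foldl_circ (l : List (GDNPRow X)) (u : GDNPWord X) :
    jetWord k (l.foldl (fun t A => t.circ A.word) u) =
      jetWord k u * (l.map fun A => unitCirc k (jetWord k A.word)).prod := by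
  induction l generalizing u with
  | nil => simp
  | cons A l ih => rw [List.foldl_cons, ih, jetWord_circ, List.map_cons, List.prod_cons, mul_assoc]

theorem jetWord_foldr_dot (l : List X) (u : GDNPWord X) :
    jetWord k (l.foldr (fun b t => (GDNPWord.of b).dot t) u) =
      (l.map fun b => .X (.inl b)).prod * jetWord k u := by
  induction l with
  | nil => simp
  | cons b l ih =>
    rw [List.foldr_cons, List.map_cons, List.prod_cons, mul_assoc, ← ih]
    rfl

/-! ### Exponents of monomials as pairs of multisets -/

open scoped Classical in
/-- Pairs of a multiset of letters and a multiset of jets of positive order are the exponents of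
the monomials in the jets. -/
noncomputable def jetExponent : Multiset X × Multiset (ℕ × WithBot X) ≃+ (Jet X →₀ ℕ) :=
  (Multiset.toFinsupp.prodCongr Multiset.toFinsupp).trans
    Finsupp.sumFinsuppAddEquivProdFinsupp.symm

theorem jetExponent_singleton_left (x : X) :
    jetExponent ({x}, 0) = Finsupp.single (.inl x : Jet X) 1 := by
  classical
  ext i
  rcases i with y | j
  · change Multiset.toFinsupp {x} y = _
    simp [Finsupp.single_apply]
  · change Multiset.toFinsupp (0 : Multiset (ℕ × WithBot X)) j = _
    simp

theorem jetExponent_singleton_right (j : ℕ × WithBot X) :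
    jetExponent (0, {j}) = Finsupp.single (.inr j : Jet X) 1 := by
  classical
  ext i
  rcases i with y | i
  · change Multiset.toFinsupp (0 : Multiset X) y = _
    simp
  · change Multiset.toFinsupp {j} i = _
    simp [Finsupp.single_apply]

theorem jetExponent_induction {P : Multiset X × Multiset (ℕ × WithBot X) → Prop} (zero : P (0, 0))
    (left : ∀ x y z, P (y, z) → P (x ::ₘ y, z)) (right : ∀ j z, P (0, z) → P (0, j ::ₘ z)) :
    ∀ y z, P (y, z) := by
  intro y z
  induction y using Multiset.induction with
  | empty =>
    induction z using Multiset.induction with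
    | empty => exact zero
    | cons j z ih => exact right j z ih
  | cons x y ih => exact left x y z ih

theorem jetExponent_cons_left (x : X) (y : Multiset X) (z : Multiset (ℕ × WithBot X)) :
    jetExponent (x ::ₘ y, z) = Finsupp.single (.inl x) 1 + jetExponent (y, z) := by
  rw [← jetExponent_singleton_left, ← map_add, Prod.mk_add_mk, zero_add, Multiset.singleton_add]

theorem jetExponent_cons_right (j : ℕ × WithBot X) (y : Multiset X)
    (z : Multiset (ℕ × WithBot X)) :
    jetExponent (y, j ::ₘ z) = Finsupp.single (.inr j) 1 + jetExponent (y, z) := by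
  rw [← jetExponent_singleton_right, ← map_add, Prod.mk_add_mk, zero_add, Multiset.singleton_add]

theorem monomial_jetExponent (y : Multiset X) (z : Multiset (ℕ × WithBot X)) :
    (monomial (jetExponent (y, z)) 1 : JetAlgebra k X) =
      (y.map fun x => .X (.inl x)).prod * (z.map fun j => .X (.inr j)).prod := by
  refine jetExponent_induction (P := fun t => (monomial (jetExponent t) 1 : JetAlgebra k X) =
    (t.1.map fun x => .X (.inl x)).prod * (t.2.map fun j => .X (.inr j)).prod) ?_ ?_ ?_ y z
  · simp [← Prod.zero_eq_mk]
  · intro x y z h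
    rw [jetExponent_cons_left, ← mul_one (1 : k), ← monomial_mul, h]
    simp [MvPolynomial.X, mul_assoc]
  · intro j z h
    rw [jetExponent_cons_right, ← mul_one (1 : k), ← monomial_mul, h]
    simp [MvPolynomial.X]

theorem weight_jetPos_jetExponent (y : Multiset X) (z : Multiset (ℕ × WithBot X)) :
    Finsupp.weight jetPos (jetExponent (y, z)) = z.card := by
  refine jetExponent_induction (P := fun t => Finsupp.weight jetPos (jetExponent t) = t.2.card)
    ?_ ?_ ?_ y z
  · simp [← Prod.zero_eq_mk]
  · intro x y z h
    rw [jetExponent_cons_left, map_add, h, Finsupp.weight_single]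
    simp [jetPos]
  · intro j z h
    rw [jetExponent_cons_right, map_add, h, Finsupp.weight_single]
    simp [jetPos, add_comm]

/-- An outer `e` contributes the factor `1` and disappears from the monomial. -/
theorem prod_jetLetter (l : List (WithBot X)) :
    (l.map (jetLetter k)).prod = ((WithBot.unbotList l).map fun x => .X (.inl x)).prod := by
  induction l with
  | nil => rfl
  | cons a l ih =>
    rw [List.map_cons, List.prod_cons, ih]
    induction a with
    | bot => exact one_mul _
    | coe x => rw [WithBot.unbotList_coe_cons, List.map_cons, List.prod_cons]; rfl

theorem prod_rowLead (l : List (GDNPRow X)) :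
    (l.map (rowLead k)).prod = ((l.flatMap GDNPRow.outer).map (jetLetter k)).prod *
      ((l.map GDNPRow.key).map fun j => .X (.inr j)).prod := by
  induction l with
  | nil => simp
  | cons A l ih =>
    simp only [List.map_cons, List.prod_cons, ih, rowLead, List.flatMap_cons, List.map_append,
      List.prod_append]
    ring

/-! ### Tableaux as a basis -/

variable [LinearOrder X]

/-- Leading parts are multiplicative: the `b_i` and the first letter have order `0` and are their
own leading parts, and each row contributes one jet of positive order. -/
theorem isLeading_tableau (T : GDNPTableau X) :
    IsLeading (Finsupp.weight jetOrder (jetExponent T.lead))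
      (Finsupp.weight jetPos (jetExponent T.lead)) (jetWord k T.word)
      (monomial (jetExponent T.lead) 1) := by
  have hm : (monomial (jetExponent T.lead) 1 : JetAlgebra k X) =
      (T.coeff.map fun b => .X (.inl b)).prod *
        (jetLetter k T.first * (T.rows.map (rowLead k)).prod) := by
    rw [GDNPTableau.lead, monomial_jetExponent, GDNPTableau.outerLetters, Multiset.coe_add,
      Multiset.map_coe, Multiset.map_coe, Multiset.prod_coe, Multiset.prod_coe, List.map_append,
      List.prod_append, ← prod_jetLetter, GDNPTableau.chain, List.map_cons, List.prod_cons,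
      prod_rowLead]
    ring
  have hc : (T.coeff.map fun b => (.X (.inl b) : JetAlgebra k X)).prod ∈
      jetFiltration k X 0 0 := by
    refine prod_mem_jetFiltration_zero fun p hp => ?_
    obtain ⟨c, -, rfl⟩ := List.mem_map.1 hp
    exact X_inl_mem_jetFiltration c
  have h := (IsLeading.refl hc).mul
    ((IsLeading.refl (jetLetter_mem_jetFiltration T.first)).mul (isLeading_rows T.rows))
  have hw : jetWord k T.word = (T.coeff.map fun b => .X (.inl b)).prod *
      (jetLetter k T.first * (T.rows.map fun A => unitCirc k (jetWord k A.word)).prod) := by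
    rw [GDNPTableau.word, jetWord_foldr_dot, jetWord_foldl_circ, jetWord, evalWord_letter]
  rw [← hm, ← hw] at h
  have hd : Finsupp.weight jetPos (jetExponent T.lead) = 0 + (0 + T.rows.length) := by
    rw [GDNPTableau.lead, weight_jetPos_jetExponent]
    simp
  -- The total order need not be computed: it is read off from the filtration in which the monomial
  -- is already known to lie.
  have ho : Finsupp.weight jetOrder (jetExponent T.lead) =
      0 + (0 + (T.rows.map fun A => A.key.1 + 1).sum) :=
    weight_eq_of_monomial_mem h.1
  rw [hd, ho]
  exact h

/-- Tableaux correspond to the exponents of their leading monomials in the jets. -/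
noncomputable def tableauEquiv : GDNPTableau X ≃ (Jet X →₀ ℕ) :=
  GDNPTableau.leadEquiv.trans jetExponent.toEquiv

variable (k X) in
/-- The linear map sending the leading monomial of every tableau to the value of the tableau. -/
noncomputable def tableauMap : JetAlgebra k X →ₗ[k] JetAlgebra k X :=
  (basisMonomials (Jet X) k).constr k fun m => jetWord k (tableauEquiv.symm m).word

theorem tableauMap_monomial (T : GDNPTableau X) :
    tableauMap k X (monomial (tableauEquiv T) 1) = jetWord k T.word := by
  have h := (basisMonomials (Jet X) k).constr_basis k
    (fun m => jetWord k (tableauEquiv.symm m).word) (tableauEquiv T)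
  rwa [coe_basisMonomials, Equiv.symm_apply_apply] at h

theorem tableauMap_bijective : Function.Bijective (tableauMap k X) := by
  refine (basisMonomials (Jet X) k).bijective_of_unitriangular _ (Finsupp.weight jetOrder)
    (Finsupp.weight jetPos) weight_jetPos_le fun m => ?_
  obtain ⟨T, rfl⟩ := tableauEquiv.surjective m
  rw [coe_basisMonomials, ← jetFiltration_eq_span, tableauMap_monomial]
  exact (isLeading_tableau T).2

end GDNP

theorem theorem2p1 (k : Type*) [Field k] (X : Type*) [LinearOrder X] [WellFoundedLT X] :
    ∃ b : Module.Basis (GDNPTableau X) k (GDNP k X),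
      ∀ T : GDNPTableau X, b T = GDNP.ofWord k T.word := by
  -- The basis of monomials is sent to the tableau values by `tableauMap`, carried back to the free
  -- algebra, and indexed by tableaux instead of exponents.
  refine ⟨(((MvPolynomial.basisMonomials (GDNP.Jet X) k).map
    (LinearEquiv.ofBijective (GDNP.tableauMap k X) GDNP.tableauMap_bijective)).map
    (GDNP.jetEquiv k X).symm).reindex GDNP.tableauEquiv.symm, fun T => ?_⟩
  rw [Module.Basis.reindex_apply, Module.Basis.map_apply, Module.Basis.map_apply,
    LinearEquiv.symm_apply_eq, MvPolynomial.coe_basisMonomials]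
  exact (GDNP.tableauMap_monomial T).trans (GDNP.toJet_ofWord k T.word).symm
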